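/- Hypergraphs are finite and may have repeated edges; $|\mathcal H|$ is the number of edges of $\mathcal H$ counted with multiplicity. For a hypergraph $\mathcal H$ on a finite vertex set $V$ and $A\subseteq V$, let $d(A)$ be the number of edges (with multiplicity) containing $A$, and for an integer $j\ge 0$ let $M_j(A)$ be the number of edges $S\in\mathcal H$ (with multiplicity) with $|A\cap S|\ge j$. For a real number $0<q\le 1$ and positive integers $r_1>\cdots>r_m$, the hypergraph $\mathcal H$ is called $(q;r_1,\ldots,r_m)$-spread if it has at least one edge, every edge has size at most $r_1$, and for every $A\subseteq V$ with $d(A)>0$ and every $1\le i<m$ with $r_i\ge |A|\ge r_{i+1}$ one has $M_j(A)\le q^j|\mathcal H|$ for all integers $j\ge r_{i+1}$. **Theorem.** For every real number $K$ there is a constant $K_0>0$, depending only on $K$, such that the following holds. Let $\ell\ge 1$, let $\mathcal H$ be a $(q;r_1,\ldots,r_\ell,1)$-spread hypergraph on a finite set $V$, and let $s=\min_{S\in\mathcal H}|S|$. Assume that $r_1\le Kq|V|$, that $\log r_i\le K r_{i+1}$ for every $1\le i<\ell$ with $r_i>s$, and that $r_\ell\le\max\{s,\,K_0\log(\ell+1)\}$.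 Let $C\ge K_0$ be a real number with $C\ell q\le 1$. If $W$ is chosen uniformly at random among the subsets of $V$ of size $\lfloor C\ell q|V|\rfloor$, then $$\Pr[W\text{ contains an edge of }\mathcal H]\ \ge\ 1-\frac{K_0}{C\ell}.$$ -/

import Mathlib

open Finset

/-- A finite hypergraph on `V` in which edges may be repeated: a multiset of subsets of `V`. -/
abbrev MultiHypergraph (V : Type*) := Multiset (Finset V)

namespace MultiHypergraph

variable {V : Type*} [DecidableEq V]

/-- `d(A)`: the number of edges, with multiplicity, that contain `A`. -/
def degree (H : MultiHypergraph V) (A : Finset V) : ℕ :=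
  H.countP (fun S => A ⊆ S)

/-- `M_j(A)`: the number of edges, with multiplicity, that meet `A` in at least `j` vertices. -/
def numMeeting (H : MultiHypergraph V) (j : ℕ) (A : Finset V) : ℕ :=
  H.countP (fun S => j ≤ #(A ∩ S))

/-- `H` is `(q; r 1, …, r m)`-spread. Only the values `r 1, …, r m` of `r` are used. -/
structure IsSpread (H : MultiHypergraph V) (q : ℝ) (m : ℕ) (r : ℕ → ℕ) : Prop where
  q_pos : 0 < q
  q_le_one : q ≤ 1
  one_le_length : 1 ≤ m
  pos : ∀ i, 1 ≤ i → i ≤ m → 0 < r i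
  decreasing : ∀ i, 1 ≤ i → i < m → r (i + 1) < r i
  nonempty : H ≠ 0
  bounded : ∀ S ∈ H, #S ≤ r 1
  spread : ∀ A : Finset V, 0 < H.degree A →
    ∀ i, 1 ≤ i → i < m → #A ≤ r i → r (i + 1) ≤ #A →
      ∀ j, r (i + 1) ≤ j → (H.numMeeting j A : ℝ) ≤ q ^ j * (Multiset.card H : ℝ)

/-- The smallest size of an edge (meaningful when there is at least one edge). -/
noncomputable def minEdgeSize {V : Type*} (H : MultiHypergraph V) : ℕ :=
  sInf {n : ℕ | ∃ S ∈ H, #S = n}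

/-- The probability that a uniformly random `m`-element subset `W` of `V` contains an edge of `H`
(for `m ≤ |V|`). -/
noncomputable def probContainsEdge [Fintype V] (H : MultiHypergraph V) (m : ℕ) : ℝ :=
  (#{W ∈ powersetCard m (univ : Finset V) | ∃ S ∈ H, S ⊆ W} : ℝ) /
    (#(powersetCard m (univ : Finset V)) : ℝ)

end MultiHypergraph

/-! Replace the uniform `W` by a union of independent biased sets, one per round. A round with
random set `W` tries to exchange each current edge `S` for a remainder `S' \ W`, where `S'` is a
current edge with `S' ⊆ W ∪ S` and the remainder has at most `r_{i+1}` vertices. The remainder lies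
inside `S`, so the new family inherits the spread bounds of the original one at the next scale, and
a biased set containing a remainder completes an edge. An edge admitting no exchange is, inside `Z =
W ∪ S`, an edge that meets every edge contained in `Z` in more than `r_{i+1}` vertices. Planting `S`
turns the count of such edges into a weighted sum over `Z`, and only pairs with large intersection
enter its second moment; spreadness then bounds the expected count (`biasedMean_card_bad_le`). Once
remainders have at most `r_ℓ` vertices, Chebyshev's inequality finishes (`biasedMean_no_edge_le`).
Since `r` is strictly decreasing, the exponent in the loss grows as rounds get further from the last
one. Geometrically decreasing densities therefore give total density `O(xqℓ)` and total failure
`O(1/(xℓ))`, where `x` is proportional to `C`. Monotonicity in the size of `W` transfers this to the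
uniform model. -/

/-! ### Product measure on subsets -/

section BiasedMean

variable {V : Type*}

/-- The mean of `F W`, where `W` contains each element of `s` independently with probability `p`. -/
noncomputable def biasedMean (p : ℝ) (s : Finset V) (F : Finset V → ℝ) : ℝ :=
  ∑ W ∈ s.powerset, p ^ #W * (1 - p) ^ (#s - #W) * F W

theorem biasedMean_congr {p : ℝ} {s : Finset V} {F G : Finset V → ℝ}
    (h : ∀ W ⊆ s, F W = G W) : biasedMean p s F = biasedMean p s G :=
  sum_congr rfl fun W hW => by rw [h W (mem_powerset.1 hW)]

theorem biasedMean_mono {p : ℝ} (h0 : 0 ≤ p) (h1 : p ≤ 1) {s : Finset V}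
    {F G : Finset V → ℝ} (h : ∀ W ⊆ s, F W ≤ G W) : biasedMean p s F ≤ biasedMean p s G :=
  sum_le_sum fun W hW => mul_le_mul_of_nonneg_left (h W (mem_powerset.1 hW))
    (mul_nonneg (pow_nonneg h0 _) (pow_nonneg (sub_nonneg.2 h1) _))

theorem biasedMean_add (p : ℝ) (s : Finset V) (F G : Finset V → ℝ) :
    biasedMean p s (fun W => F W + G W) = biasedMean p s F + biasedMean p s G := by
  simp only [biasedMean, mul_add, sum_add_distrib]

theorem biasedMean_const_mul (p : ℝ) (s : Finset V) (c : ℝ) (F : Finset V → ℝ) :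
    biasedMean p s (fun W => c * F W) = c * biasedMean p s F := by
  simp only [biasedMean, mul_sum]
  exact sum_congr rfl fun W _ => by ring

theorem biasedMean_sum {ι : Type*} (p : ℝ) (s : Finset V) (J : Finset ι)
    (F : ι → Finset V → ℝ) :
    biasedMean p s (fun W => ∑ e ∈ J, F e W) = ∑ e ∈ J, biasedMean p s (F e) := by
  simp only [biasedMean, mul_sum]
  exact sum_comm

theorem biasedMean_pow_card (p c : ℝ) (s : Finset V) :
    biasedMean p s (fun W => c ^ #W) = (p * c + (1 - p)) ^ #s := by
  rw [← sum_pow_mul_eq_add_pow]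
  exact sum_congr rfl fun W _ => by rw [mul_pow]; ring

theorem biasedMean_const (p : ℝ) (s : Finset V) (c : ℝ) :
    biasedMean p s (fun _ => c) = c := by
  have h := biasedMean_const_mul p s c (fun W => 1 ^ #W)
  rw [biasedMean_pow_card] at h
  simpa using h

theorem sq_biasedMean_le {p : ℝ} (h0 : 0 ≤ p) (h1 : p ≤ 1) (s : Finset V)
    (F : Finset V → ℝ) : biasedMean p s F ^ 2 ≤ biasedMean p s (fun W => F W ^ 2) := by
  set m := biasedMean p s F with hm
  have h : biasedMean p s (fun W => 2 * m * F W + -m ^ 2) ≤ biasedMean p s (fun W => F W ^ 2) :=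
    biasedMean_mono h0 h1 fun W _ => by nlinarith [sq_nonneg (F W - m)]
  rw [biasedMean_add, biasedMean_const_mul, biasedMean_const, ← hm] at h
  nlinarith

/-- Chebyshev's inequality for the event that a variable vanishes. -/
theorem biasedMean_eq_zero_mul_sq_le {p : ℝ} (h0 : 0 ≤ p) (h1 : p ≤ 1) (s : Finset V)
    (F : Finset V → ℝ) :
    biasedMean p s (fun W => if F W = 0 then 1 else 0) * biasedMean p s F ^ 2 ≤
      biasedMean p s (fun W => F W ^ 2) - biasedMean p s F ^ 2 := by
  set m := biasedMean p s F with hm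
  have h : biasedMean p s (fun W => m ^ 2 * (if F W = 0 then 1 else 0)) ≤
      biasedMean p s (fun W => F W ^ 2 + (-(2 * m) * F W + m ^ 2)) :=
    biasedMean_mono h0 h1 fun W _ => by
      split_ifs with hF
      · rw [hF]; nlinarith
      · nlinarith [sq_nonneg (F W - m)]
  rw [biasedMean_const_mul, biasedMean_add, biasedMean_add, biasedMean_const_mul,
    biasedMean_const, ← hm] at h
  nlinarith

variable [DecidableEq V]

theorem biasedMean_insert (p : ℝ) {s : Finset V} {a : V} (ha : a ∉ s) (F : Finset V → ℝ) :
    biasedMean p (insert a s) F =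
      (1 - p) * biasedMean p s F + p * biasedMean p s (fun W => F (insert a W)) := by
  simp only [biasedMean]
  rw [sum_powerset_insert ha, mul_sum, mul_sum, card_insert_of_notMem ha]
  congr 1
  · refine sum_congr rfl fun W hW => ?_
    have := card_le_card (mem_powerset.1 hW)
    rw [Nat.succ_sub this, pow_succ]
    ring
  · refine sum_congr rfl fun W hW => ?_
    have haW : a ∉ W := fun h => ha (mem_powerset.1 hW h)
    rw [card_insert_of_notMem haW, Nat.succ_sub_succ, pow_succ]
    ring

/-- The union of independent `p`- and `p'`-biased sets is a biased set. -/
theorem biasedMean_union (p p' : ℝ) (s : Finset V) (F : Finset V → ℝ) :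
    biasedMean p s (fun W => biasedMean p' s (fun W' => F (W ∪ W'))) =
      biasedMean (1 - (1 - p) * (1 - p')) s F := by
  induction s using Finset.induction_on generalizing F with
  | empty => simp [biasedMean]
  | insert a s ha ih =>
    simp only [biasedMean_insert _ ha, biasedMean_add, biasedMean_const_mul, insert_union,
      union_insert, insert_idem]
    rw [ih F, ih (fun W => F (insert a W))]
    ring

theorem biasedMean_mem (p : ℝ) {s : Finset V} {a : V} (ha : a ∈ s) (F : Finset V → ℝ) :
    biasedMean p s (fun Z => if a ∈ Z then F Z else 0) =
      p * biasedMean p s (fun W => F (insert a W)) := by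
  obtain ⟨t, hat, rfl⟩ : ∃ t, a ∉ t ∧ insert a t = s :=
    ⟨s.erase a, notMem_erase a s, insert_erase ha⟩
  simp only [biasedMean_insert p hat, mem_insert_self, if_true, insert_idem]
  have h : biasedMean p t (fun Z => if a ∈ Z then F Z else 0) = 0 := by
    refine (biasedMean_congr fun W hW => ?_).trans (biasedMean_const p t 0)
    exact if_neg fun h => hat (hW h)
  rw [h]
  ring

/-- Planting: conditioned on containing `S`, a biased set is distributed as `W ∪ S`. -/
theorem biasedMean_superset (p : ℝ) {s S : Finset V} (hS : S ⊆ s) (F : Finset V → ℝ) :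
    biasedMean p s (fun Z => if S ⊆ Z then F Z else 0) =
      p ^ #S * biasedMean p s (fun W => F (W ∪ S)) := by
  induction S using Finset.induction_on generalizing F with
  | empty => simp
  | insert a S ha ih =>
    have h1 : biasedMean p s (fun Z => if insert a S ⊆ Z then F Z else 0) =
        biasedMean p s (fun Z => if a ∈ Z then (if S ⊆ Z then F Z else 0) else 0) :=
      biasedMean_congr fun W _ => by simp only [insert_subset_iff, ite_and]
    have h2 : biasedMean p s (fun W => if S ⊆ insert a W then F (insert a W) else 0) =
        biasedMean p s (fun W => if S ⊆ W then F (insert a W) else 0) :=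
      biasedMean_congr fun W _ => by simp only [subset_insert_iff_of_notMem ha]
    rw [h1, biasedMean_mem p (hS (mem_insert_self a S)), h2,
      ih ((subset_insert a S).trans hS) (fun W => F (insert a W)), card_insert_of_notMem ha,
      pow_succ]
    simp only [union_insert]
    ring

theorem biasedMean_superset_one (p : ℝ) {s S : Finset V} (hS : S ⊆ s) :
    biasedMean p s (fun Z => if S ⊆ Z then 1 else 0) = p ^ #S := by
  rw [biasedMean_superset p hS (fun _ => 1), biasedMean_const, mul_one]

end BiasedMean

/-! ### Moment estimates for one round -/

section Stages

variable {V ι : Type*} [Fintype V] [DecidableEq V]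

/-- The indicator of `S ⊆ Z`, normalised to have mean one for a `p`-biased set `Z`. -/
noncomputable def subsetWeight (p : ℝ) (S Z : Finset V) : ℝ :=
  if S ⊆ Z then p⁻¹ ^ #S else 0

omit [Fintype V] in
theorem subsetWeight_nonneg {p : ℝ} (hp : 0 < p) (S Z : Finset V) : 0 ≤ subsetWeight p S Z := by
  unfold subsetWeight
  split_ifs <;> positivity

/-- The indicator that `W` contains no edge of the family `g` over `J`. -/
noncomputable def noEdge (J : Finset ι) (g : ι → Finset V) (W : Finset V) : ℝ :=
  if ∀ e ∈ J, ¬ g e ⊆ W then 1 else 0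

/-- The edges `g e` for which every edge contained in `W ∪ g e` has more than `k` vertices
outside `W`. -/
def badEdges (J : Finset ι) (g : ι → Finset V) (k : ℕ) (W : Finset V) : Finset ι :=
  {e ∈ J | ∀ e' ∈ J, g e' ⊆ W ∪ g e → k < #(g e' \ W)}

omit [Fintype V] in
theorem mem_badEdges {J : Finset ι} {g : ι → Finset V} {k : ℕ} {W : Finset V} {e : ι} :
    e ∈ badEdges J g k W ↔ e ∈ J ∧ ∀ e' ∈ J, g e' ⊆ W ∪ g e → k < #(g e' \ W) :=
  mem_filter

omit [Fintype V] in
theorem noEdge_le_one (J : Finset ι) (g : ι → Finset V) (W : Finset V) : noEdge J g W ≤ 1 := by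
  unfold noEdge
  split_ifs <;> norm_num

omit [Fintype V] in
theorem noEdge_le_noEdge {J J' : Finset ι} {g g' : ι → Finset V} {W W' : Finset V}
    (h : ∀ e ∈ J', g' e ⊆ W' → ∃ e' ∈ J, g e' ⊆ W) : noEdge J g W ≤ noEdge J' g' W' := by
  by_cases hW : ∀ e ∈ J, ¬ g e ⊆ W
  · have hW' : ∀ e ∈ J', ¬ g' e ⊆ W' := fun e he hs =>
      let ⟨e', he', hs'⟩ := h e he hs
      hW e' he' hs'
    rw [noEdge, noEdge, if_pos hW, if_pos hW']
  · rw [noEdge, noEdge, if_neg hW]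
    split_ifs <;> norm_num

theorem biasedMean_subsetWeight_mul {p : ℝ} (hp : 0 < p) (S T : Finset V) :
    biasedMean p univ (fun Z => subsetWeight p S Z * subsetWeight p T Z) = p⁻¹ ^ #(S ∩ T) := by
  have h : biasedMean p univ (fun Z => subsetWeight p S Z * subsetWeight p T Z) =
      biasedMean p univ (fun Z => p⁻¹ ^ (#S + #T) * (if S ∪ T ⊆ Z then 1 else 0)) :=
    biasedMean_congr fun Z _ => by
      simp only [subsetWeight, union_subset_iff]
      by_cases hS : S ⊆ Z <;> by_cases hT : T ⊆ Z <;> simp [hS, hT, pow_add]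
  rw [h, biasedMean_const_mul, biasedMean_superset_one p (subset_univ _),
    ← card_union_add_card_inter, pow_add, mul_right_comm, ← mul_pow, inv_mul_cancel₀ hp.ne',
    one_pow, one_mul]

theorem biasedMean_subsetWeight {p : ℝ} (hp : 0 < p) (S : Finset V) :
    biasedMean p univ (subsetWeight p S) = 1 := by
  have h := biasedMean_subsetWeight_mul hp S ∅
  rw [inter_empty, card_empty, pow_zero] at h
  rw [← h]
  exact biasedMean_congr fun Z _ => by simp [subsetWeight]

-- Each summand is one term of the sum of `p⁻¹ ^ j` over `m ≤ j ≤ #(A ∩ g e)`. Exchanging the sums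
-- leaves a geometric series of ratio `q / p ≤ 1 / 2`.
omit [Fintype V] in
theorem sum_inv_pow_card_inter_le {p q N : ℝ} (hq : 0 ≤ q) (hp : 0 < p) (hpq : 2 * q ≤ p)
    (hN : 0 ≤ N) (J : Finset ι) (g : ι → Finset V) (A : Finset V) (m : ℕ)
    (h : ∀ j, m ≤ j → (#{e ∈ J | j ≤ #(A ∩ g e)} : ℝ) ≤ q ^ j * N) :
    ∑ e ∈ J with m ≤ #(A ∩ g e), p⁻¹ ^ #(A ∩ g e) ≤ 2 * (q / p) ^ m * N := by
  have hx : q / p ≤ 1 / 2 := by rw [div_le_iff₀ hp]; linarith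
  have hx0 : 0 ≤ q / p := div_nonneg hq hp.le
  calc ∑ e ∈ J with m ≤ #(A ∩ g e), p⁻¹ ^ #(A ∩ g e)
      ≤ ∑ e ∈ J, ∑ j ∈ Ico m (#A + 1), if j ≤ #(A ∩ g e) then p⁻¹ ^ j else 0 := by
        rw [sum_filter]
        refine sum_le_sum fun e _ => ?_
        have h0 : ∀ j ∈ Ico m (#A + 1), 0 ≤ if j ≤ #(A ∩ g e) then p⁻¹ ^ j else 0 := by
          intro j _
          split_ifs <;> positivity
        split_ifs with hm
        · have h1 := single_le_sum h0 (mem_Ico.2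
            ⟨hm, Nat.lt_succ_of_le (card_le_card (inter_subset_left (s₁ := A) (s₂ := g e)))⟩)
          simpa using h1
        · exact sum_nonneg h0
    _ = ∑ j ∈ Ico m (#A + 1), p⁻¹ ^ j * (#{e ∈ J | j ≤ #(A ∩ g e)} : ℝ) := by
        rw [sum_comm]
        refine sum_congr rfl fun j _ => ?_
        rw [← sum_filter, sum_const, nsmul_eq_mul, mul_comm]
    _ ≤ ∑ j ∈ Ico m (#A + 1), (q / p) ^ j * N := by
        refine sum_le_sum fun j hj => ?_
        calc p⁻¹ ^ j * (#{e ∈ J | j ≤ #(A ∩ g e)} : ℝ) ≤ p⁻¹ ^ j * (q ^ j * N) :=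
              mul_le_mul_of_nonneg_left (h j (mem_Ico.1 hj).1) (by positivity)
          _ = (q / p) ^ j * N := by rw [div_eq_mul_inv, mul_pow]; ring
    _ = (∑ j ∈ Ico m (#A + 1), (q / p) ^ j) * N := (sum_mul _ _ _).symm
    _ ≤ 2 * (q / p) ^ m * N := by
        refine mul_le_mul_of_nonneg_right ?_ hN
        refine (geom_sum_Ico_le_of_lt_one hx0 (by linarith)).trans ?_
        rw [div_le_iff₀ (by linarith)]
        nlinarith [pow_nonneg hx0 m]

/-- After one round, the expected number of edges `g e` that cannot be replaced by an edge
contained in `g e ∪ W` with at most `k` vertices outside `W`. -/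
theorem biasedMean_card_bad_le {p q N : ℝ} (hq : 0 ≤ q) (hp : 0 < p) (hp1 : p ≤ 1)
    (hpq : 2 * q ≤ p) (J : Finset ι) (hJ : (#J : ℝ) ≤ N) (g : ι → Finset V) (k : ℕ)
    (h : ∀ e ∈ J, ∀ j, k + 1 ≤ j → (#{e' ∈ J | j ≤ #(g e ∩ g e')} : ℝ) ≤ q ^ j * N) :
    biasedMean p univ (fun W => (#(badEdges J g k W) : ℝ)) ≤
      2 * √(q / p) ^ (k + 1) * N := by
  classical
  have hN : 0 ≤ N := (Nat.cast_nonneg _).trans hJ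
  have hx0 : 0 ≤ q / p := div_nonneg hq hp.le
  -- If `e` is bad for `W`, it is special for `Z = W ∪ g e`, because `g e' \ W ⊆ g e ∩ g e'`
  -- whenever `g e' ⊆ Z`. Unlike badness, this condition depends on `W` only through `Z`.
  let special (e : ι) (Z : Finset V) : Prop := ∀ e' ∈ J, g e' ⊆ Z → k < #(g e ∩ g e')
  let B (Z : Finset V) : ℝ := ∑ e ∈ J, if special e Z then subsetWeight p (g e) Z else 0
  have hB0 : 0 ≤ biasedMean p univ B := by
    rw [← biasedMean_const p (univ : Finset V) 0]
    refine biasedMean_mono hp.le hp1 fun Z _ => sum_nonneg fun e _ => ?_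
    split_ifs
    exacts [subsetWeight_nonneg hp _ _, le_rfl]
  have hbad : biasedMean p univ (fun W => (#(badEdges J g k W) : ℝ)) ≤ biasedMean p univ B := by
    calc biasedMean p univ (fun W => (#(badEdges J g k W) : ℝ))
        ≤ biasedMean p univ (fun W => ∑ e ∈ J, if special e (W ∪ g e) then 1 else 0) := by
          refine biasedMean_mono hp.le hp1 fun W _ => ?_
          rw [sum_boole]
          refine Nat.cast_le.2 (card_le_card (monotone_filter_right _ ?_))
          intro e _ he e' he' hsub
          refine (he e' he' hsub).trans_le (card_le_card fun v hv => ?_)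
          rw [mem_sdiff] at hv
          exact mem_inter.2 ⟨(mem_union.1 (hsub hv.1)).resolve_left hv.2, hv.1⟩
      _ = biasedMean p univ B := by
          rw [biasedMean_sum, biasedMean_sum]
          refine sum_congr rfl fun e _ => ?_
          have h1 : biasedMean p univ
              (fun Z => if special e Z then subsetWeight p (g e) Z else 0) =
              biasedMean p univ (fun Z => p⁻¹ ^ #(g e) *
                (if g e ⊆ Z then (if special e Z then 1 else 0) else 0)) :=
            biasedMean_congr fun Z _ => by
              unfold subsetWeight
              split_ifs <;> simp
          rw [h1, biasedMean_const_mul, biasedMean_superset p (subset_univ _)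
            (fun Z => if special e Z then (1 : ℝ) else 0), ← mul_assoc, ← mul_pow,
            inv_mul_cancel₀ hp.ne', one_pow, one_mul]
  have hsq : biasedMean p univ B ^ 2 ≤ N * (2 * (q / p) ^ (k + 1) * N) := by
    refine (sq_biasedMean_le hp.le hp1 univ B).trans ?_
    calc biasedMean p univ (fun Z => B Z ^ 2)
        ≤ biasedMean p univ (fun Z => ∑ e ∈ J, ∑ e' ∈ J with k + 1 ≤ #(g e ∩ g e'),
            subsetWeight p (g e) Z * subsetWeight p (g e') Z) := by
          refine biasedMean_mono hp.le hp1 fun Z _ => ?_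
          rw [sq, sum_mul_sum]
          refine sum_le_sum fun e he => ?_
          rw [sum_filter]
          refine sum_le_sum fun e' he' => ?_
          have h1 := subsetWeight_nonneg hp (g e) Z
          have h2 := subsetWeight_nonneg hp (g e') Z
          by_cases hs : special e Z
          · by_cases hs' : special e' Z
            · rw [if_pos hs, if_pos hs']
              by_cases hZ : g e' ⊆ Z
              -- Specialness of `e` applied to `e'` forces the large intersection, so the pair
              -- survives in the filtered sum.
              · rw [if_pos (Nat.succ_le_of_lt (hs e' he' hZ))]
              · have : subsetWeight p (g e') Z = 0 := if_neg hZ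
                simp [this]
            · rw [if_neg hs', mul_zero]
              split_ifs <;> positivity
          · rw [if_neg hs, zero_mul]
            split_ifs <;> positivity
      _ = ∑ e ∈ J, ∑ e' ∈ J with k + 1 ≤ #(g e ∩ g e'), p⁻¹ ^ #(g e ∩ g e') := by
          simp only [biasedMean_sum, biasedMean_subsetWeight_mul hp]
      _ ≤ ∑ e ∈ J, 2 * (q / p) ^ (k + 1) * N :=
          sum_le_sum fun e he => sum_inv_pow_card_inter_le hq hp hpq hN J g (g e) (k + 1) (h e he)
      _ ≤ N * (2 * (q / p) ^ (k + 1) * N) := by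
          rw [sum_const, nsmul_eq_mul]
          exact mul_le_mul_of_nonneg_right hJ (by positivity)
  refine hbad.trans (abs_le_of_sq_le_sq' (hsq.trans ?_) (by positivity)).2
  have h4 : (√(q / p) ^ (k + 1)) ^ 2 = (q / p) ^ (k + 1) := by
    rw [← pow_mul, mul_comm, pow_mul, Real.sq_sqrt hx0]
  rw [mul_pow, mul_pow, h4]
  have : 0 ≤ (q / p) ^ (k + 1) * N ^ 2 := by positivity
  nlinarith

/-- The second moment bound for the final round. -/
theorem biasedMean_no_edge_le {p q N : ℝ} (hq : 0 ≤ q) (hp : 0 < p) (hp1 : p ≤ 1)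
    (hpq : 2 * q ≤ p) (J : Finset ι) (hN : 0 < N) (hJ : N ≤ 2 * #J) (g : ι → Finset V)
    (h : ∀ e ∈ J, ∀ j, 1 ≤ j → (#{e' ∈ J | j ≤ #(g e ∩ g e')} : ℝ) ≤ q ^ j * N) :
    biasedMean p univ (noEdge J g) ≤ 4 * (q / p) := by
  classical
  let X (Z : Finset V) : ℝ := ∑ e ∈ J, subsetWeight p (g e) Z
  have hmean : biasedMean p univ X = #J := by
    simp [X, biasedMean_sum, biasedMean_subsetWeight hp]
  have hle : biasedMean p univ (noEdge J g) ≤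
      biasedMean p univ (fun W => if X W = 0 then 1 else 0) := by
    refine biasedMean_mono hp.le hp1 fun W _ => ?_
    by_cases hW : ∀ e ∈ J, ¬ g e ⊆ W
    · have : X W = 0 := sum_eq_zero fun e he => if_neg (hW e he)
      rw [if_pos this]
      exact noEdge_le_one J g W
    · rw [noEdge, if_neg hW]
      split_ifs <;> norm_num
  have hsq : biasedMean p univ (fun Z => X Z ^ 2) ≤ #J * (2 * (q / p) * N + #J) := by
    calc biasedMean p univ (fun Z => X Z ^ 2)
        = ∑ e ∈ J, ∑ e' ∈ J, p⁻¹ ^ #(g e ∩ g e') := by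
          simp only [X, sq, sum_mul_sum, biasedMean_sum, biasedMean_subsetWeight_mul hp]
      _ ≤ ∑ e ∈ J, (2 * (q / p) * N + #J) := by
          refine sum_le_sum fun e he => ?_
          rw [← sum_filter_add_sum_filter_not J (fun e' => 1 ≤ #(g e ∩ g e'))]
          refine add_le_add ?_ ?_
          · simpa using sum_inv_pow_card_inter_le hq hp hpq hN.le J g (g e) 1 (h e he)
          · calc _ = ∑ e' ∈ J with ¬ 1 ≤ #(g e ∩ g e'), (1 : ℝ) := by
                  refine sum_congr rfl fun e' he' => ?_
                  have h0 : #(g e ∩ g e') = 0 := by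
                    have := (mem_filter.1 he').2
                    omega
                  rw [h0, pow_zero]
              _ ≤ #J := by
                  rw [sum_const, nsmul_eq_mul, mul_one]
                  exact Nat.cast_le.2 (card_filter_le _ _)
      _ = #J * (2 * (q / p) * N + #J) := by rw [sum_const, nsmul_eq_mul]
  have hcheb := biasedMean_eq_zero_mul_sq_le hp.le hp1 univ X
  rw [hmean] at hcheb
  refine hle.trans ?_
  have hJ0 : (0 : ℝ) < #J := by linarith
  refine le_of_mul_le_mul_right ?_ (pow_pos hJ0 2)
  have hx0 : 0 ≤ q / p := div_nonneg hq hp.le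
  have h5 : (#J : ℝ) * (2 * (q / p) * N) ≤ #J * (2 * (q / p) * (2 * #J)) := by gcongr
  nlinarith

end Stages

/-! ### Induction over the rounds -/

section Iteration

variable {V ι : Type*} [Fintype V] [DecidableEq V] [Fintype ι]

/-- The index `a` counts the rounds before the final Chebyshev round, so `b` lists the scales
upwards from `b 0 = 1`. Quantifying over all subfamilies `J` and all shrunken edges `g e ⊆ f e` lets
the induction absorb a round: lost edges are paid for by the term in `N - #J`, and the spread
hypothesis is only ever needed for `f`. -/
theorem exists_biasedMean_no_edge_le [Nonempty ι] {q x : ℝ} {ℓ : ℕ} (b : ℕ → ℕ)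
    (f : ι → Finset V) (hq : 0 < q) (hx : 16 ≤ x) (hℓ : 1 ≤ ℓ) (hxq : 2 * x * ℓ * q ≤ 1)
    (hb0 : b 0 = 1) (hb : ∀ a, a ≤ ℓ → a + 1 ≤ b a)
    (h : ∀ a < ℓ, ∀ e, ∀ A ⊆ f e, #A ≤ b (a + 1) → ∀ j, b a ≤ j →
      (#{e' : ι | j ≤ #(A ∩ f e')} : ℝ) ≤ q ^ j * Fintype.card ι) (a : ℕ) (ha : a < ℓ) :
    ∃ P : ℝ, 0 ≤ P ∧ P ≤ 1 ∧ P ≤ q * x * (ℓ + a + ℓ * (1 - (1 / 2) ^ a)) ∧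
      ∀ (J : Finset ι) (g : ι → Finset V), (∀ e ∈ J, g e ⊆ f e) →
        (∀ e ∈ J, #(g e) ≤ b (a + 1)) →
        biasedMean P univ (noEdge J g) ≤
          2 / Fintype.card ι * (Fintype.card ι - #J) + (8 - 4 * (1 / 2) ^ a) / (x * ℓ) := by
  have : DecidableEq ι := Classical.decEq ι
  set N : ℝ := (Fintype.card ι : ℝ) with hNdef
  have hN : 0 < N := Nat.cast_pos.2 Fintype.card_pos
  have hJN : ∀ J : Finset ι, (#J : ℝ) ≤ N := fun J => Nat.cast_le.2 (card_le_univ J)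
  have hℓ1 : (1 : ℝ) ≤ ℓ := by exact_mod_cast hℓ
  have hx0 : 0 < x := by linarith
  have hxℓ : 0 < x * ℓ := by positivity
  have hspread : ∀ a < ℓ, ∀ (J : Finset ι) (g : ι → Finset V), (∀ e ∈ J, g e ⊆ f e) →
      (∀ e ∈ J, #(g e) ≤ b (a + 1)) → ∀ e ∈ J, ∀ j, b a ≤ j →
      (#{e' ∈ J | j ≤ #(g e ∩ g e')} : ℝ) ≤ q ^ j * N := by
    intro a ha J g hg hgb e he j hj
    refine le_trans (Nat.cast_le.2 (card_le_card fun e' he' => ?_))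
      (h a ha e (g e) (hg e he) (hgb e he) j hj)
    rw [mem_filter] at he' ⊢
    exact ⟨mem_univ _, he'.2.trans (card_le_card (inter_subset_inter_left (hg e' he'.1)))⟩
  induction a with
  | zero =>
    have hp : 0 < q * x * ℓ := by positivity
    have hp1 : q * x * ℓ ≤ 1 := by nlinarith
    refine ⟨q * x * ℓ, hp.le, hp1, by simp, fun J g hg hgb => ?_⟩
    have hpq : 2 * q ≤ q * x * ℓ := by
      have : 1 * 16 ≤ (ℓ : ℝ) * x := mul_le_mul hℓ1 hx (by norm_num) (by positivity)
      nlinarith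
    -- The coefficient `2 / N` makes the claimed bound at least `1` once half of the edges are lost.
    by_cases hJ : N ≤ 2 * #J
    · have h1 := biasedMean_no_edge_le hq.le hp hp1 hpq J hN hJ g
        (fun e he j hj => hspread 0 ha J g hg hgb e he j (by omega))
      have h2 : q / (q * x * ℓ) = 1 / (x * ℓ) := by field_simp
      have h3 : 0 ≤ 2 / N * (N - #J) := mul_nonneg (by positivity) (sub_nonneg.2 (hJN J))
      refine h1.trans ?_
      rw [h2]
      have h4 : 4 * (1 / (x * ℓ)) = (8 - 4 * (1 / 2) ^ 0) / (x * ℓ) := by ring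
      linarith
    · have h1 : biasedMean (q * x * ℓ) univ (noEdge J g) ≤ 1 :=
        (biasedMean_mono hp.le hp1 fun W _ => noEdge_le_one J g W).trans
          (biasedMean_const _ _ 1).le
      have h2 : 1 ≤ 2 / N * (N - #J) := by
        rw [div_mul_eq_mul_div, le_div_iff₀ hN]
        linarith
      have h3 : 0 ≤ (8 - 4 * (1 / 2 : ℝ) ^ 0) / (x * ℓ) := by
        rw [pow_zero]
        exact div_nonneg (by norm_num) hxℓ.le
      exact h1.trans (h2.trans (le_add_of_nonneg_right h3))
  | succ a ih =>
    obtain ⟨P, hP0, hP1, hPle, ih⟩ := ih (by omega)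
    set y : ℝ := (1 / 2) ^ (a + 1) with hy
    have hy0 : 0 < y := by positivity
    have hy1 : y ≤ 1 := pow_le_one₀ (by norm_num) (by norm_num)
    have hya : (1 / 2 : ℝ) ^ a = 2 * y := by rw [hy, pow_succ]; ring
    rw [hya] at ih hPle
    -- The summand `1` keeps `q / p ≤ 1 / 16` in every round; `ℓ * y` gives `q / p ≤ 1 / (x * ℓ *
    -- y)`, and its total over all rounds is at most `ℓ`.
    set p : ℝ := q * x * (1 + ℓ * y) with hpdef
    have hp : 0 < p := by positivity
    have hp1 : p ≤ 1 := by
      have : p ≤ q * x * (ℓ + ℓ * 1) := by rw [hpdef]; gcongr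
      linarith
    have hqp : q / p = 1 / (x * (1 + ℓ * y)) := by
      rw [hpdef]
      field_simp
    have hqp1 : q / p ≤ 1 / (x * ℓ * y) := by
      rw [hqp]
      refine one_div_le_one_div_of_le (by positivity) ?_
      nlinarith
    have hℓy : 0 < ℓ * y := by positivity
    have hqp2 : q / p ≤ 1 / 16 := by
      rw [hqp]
      refine one_div_le_one_div_of_le (by norm_num) ?_
      nlinarith
    have hqp0 : 0 ≤ q / p := by positivity
    have hsqrt : √(q / p) ≤ 1 / 4 := by
      rw [Real.sqrt_le_left (by norm_num)]
      norm_num at hqp2 ⊢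
      exact hqp2
    have hpq : 2 * q ≤ p := by
      rw [div_le_iff₀ hp] at hqp2
      linarith
    -- The exponent is at least `a + 3`: two factors give `q / p`, and the other `a + 1`, each at
    -- most `1 / 4`, give `y * y`.
    have hloss : 2 * √(q / p) ^ (b (a + 1) + 1) ≤ 2 * y / (x * ℓ) := by
      have h1 : √(q / p) ^ (b (a + 1) + 1) ≤ √(q / p) ^ (2 + (a + 1)) :=
        pow_le_pow_of_le_one (Real.sqrt_nonneg _) (by linarith)
          (by have := hb (a + 1) ha.le; omega)
      have h2 : √(q / p) ^ (2 + (a + 1)) ≤ 1 / (x * ℓ * y) * (y * y) := by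
        rw [pow_add, Real.sq_sqrt hqp0]
        refine mul_le_mul hqp1 ?_ (by positivity) (by positivity)
        rw [hy, ← mul_pow]
        exact pow_le_pow_left₀ (Real.sqrt_nonneg _) (by linarith) _
      have h3 : 1 / (x * ℓ * y) * (y * y) = y / (x * ℓ) := by field_simp
      rw [h3] at h2
      rw [mul_div_assoc]
      linarith
    have hpP : 0 ≤ (1 - p) * (1 - P) := mul_nonneg (sub_nonneg.2 hp1) (sub_nonneg.2 hP1)
    have hPp : 1 - (1 - p) * (1 - P) = p + P * (1 - p) := by ring
    refine ⟨1 - (1 - p) * (1 - P), ?_, by linarith, ?_, fun J g hg hgb => ?_⟩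
    · rw [hPp]
      exact add_nonneg hp.le (mul_nonneg hP0 (sub_nonneg.2 hp1))
    · have h1 : q * x * (ℓ + (a + 1 : ℕ) + ℓ * (1 - y)) =
          p + q * x * (ℓ + a + ℓ * (1 - 2 * y)) := by
        rw [hpdef]
        push_cast
        ring
      have h2 : 0 ≤ P * p := mul_nonneg hP0 hp.le
      rw [hPp, h1]
      linarith
    rw [← biasedMean_union]
    let bad (W : Finset V) : Finset ι := badEdges J g (b (a + 1)) W
    have hbad : biasedMean p univ (fun W => (#(bad W) : ℝ)) ≤
        2 * √(q / p) ^ (b (a + 1) + 1) * N :=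
      biasedMean_card_bad_le hq.le hp hp1 hpq J (hJN J) g (b (a + 1))
        (fun e he j hj => hspread (a + 1) ha J g hg hgb e he j (by omega))
    have hround : ∀ W : Finset V, biasedMean P univ
        (fun W' => noEdge J g (W ∪ W')) ≤
        (2 / N * (N - #J) + (8 - 4 * (2 * y)) / (x * ℓ)) + 2 / N * #(bad W) := by
      intro W
      have hex : ∀ e ∈ J \ bad W, ∃ e' ∈ J, g e' ⊆ W ∪ g e ∧ #(g e' \ W) ≤ b (a + 1) := by
        intro e he
        rw [mem_sdiff, mem_badEdges] at he
        by_contra! hcon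
        exact he.2 ⟨he.1, hcon⟩
      choose! σ hσJ hσ hσb using hex
      have hsub : ∀ e ∈ J \ bad W, g (σ e) \ W ⊆ f e := fun e he =>
        (sdiff_le_iff.2 (hσ e he)).trans (hg e (mem_sdiff.1 he).1)
      -- The new family stays indexed by the old `e`, so `σ` need not be injective and no
      -- multiplicity is lost.
      have h1 := ih (J \ bad W) (fun e => g (σ e) \ W) hsub hσb
      have hcard : (#(J \ bad W) : ℝ) = #J - #(bad W) :=
        cast_card_sdiff fun e he => (mem_badEdges.1 he).1
      rw [hcard] at h1
      refine (biasedMean_mono hP0 hP1 fun W' _ => ?_).trans (h1.trans (by ring_nf; rfl))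
      exact noEdge_le_noEdge fun e he hs => ⟨σ e, hσJ e he, sdiff_le_iff.1 hs⟩
    refine (biasedMean_mono hp.le hp1 fun W _ => hround W).trans ?_
    rw [biasedMean_add, biasedMean_const, biasedMean_const_mul]
    have h6 : 2 / N * biasedMean p univ (fun W => (#(bad W) : ℝ)) ≤ 4 * y / (x * ℓ) := by
      calc 2 / N * biasedMean p univ (fun W => (#(bad W) : ℝ))
          ≤ 2 / N * (2 * y / (x * ℓ) * N) := by
            refine mul_le_mul_of_nonneg_left (hbad.trans ?_) (by positivity)
            exact mul_le_mul_of_nonneg_right hloss hN.le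
        _ = 4 * y / (x * ℓ) := by field_simp; ring
    have h7 : (8 - 4 * (2 * y)) / (x * ℓ) + 4 * y / (x * ℓ) = (8 - 4 * y) / (x * ℓ) := by
      rw [← add_div]
      ring
    linarith

end Iteration

/-! ### From the product measure to sets of fixed size -/

section FixedSize

variable {V : Type*} [Fintype V] [DecidableEq V]

/-- The proportion of the `m`-element subsets of `V` that satisfy `Q`. -/
noncomputable def layerDensity (Q : Finset V → Prop) [DecidablePred Q] (m : ℕ) : ℝ :=
  (#{W ∈ powersetCard m (univ : Finset V) | Q W} : ℝ) / (Fintype.card V).choose m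

/-- The local LYM inequality: the shadow of a layer of a down-set has at least the same density and
stays in the down-set. -/
theorem layerDensity_antitone {Q : Finset V → Prop} [DecidablePred Q]
    (hQ : ∀ W W', W ⊆ W' → Q W' → Q W) : Antitone (layerDensity Q) := by
  refine antitone_nat_of_succ_le fun m => ?_
  refine (local_lubell_yamamoto_meshalkin_inequality_div m.succ_ne_zero
    (fun W hW => (mem_powersetCard.1 (mem_filter.1 hW).1).2)).trans ?_
  rw [Nat.succ_sub_one]
  refine div_le_div_of_nonneg_right (Nat.cast_le.2 (card_le_card fun W hW => ?_))
    (Nat.cast_nonneg _)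
  obtain ⟨a, ha, hW⟩ := mem_shadow_iff_insert_mem.1 hW
  rw [mem_filter, mem_powersetCard, card_insert_of_notMem ha] at hW
  rw [mem_filter, mem_powersetCard]
  exact ⟨⟨subset_univ _, Nat.succ_injective hW.1.2⟩, hQ _ _ (subset_insert a W) hW.2⟩

omit [DecidableEq V] in
theorem layerDensity_le_one (Q : Finset V → Prop) [DecidablePred Q] (m : ℕ) :
    layerDensity Q m ≤ 1 := by
  refine div_le_one_of_le₀ (Nat.cast_le.2 ?_) (Nat.cast_nonneg _)
  exact (card_filter_le _ _).trans (card_powersetCard m (univ : Finset V)).le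

omit [DecidableEq V] in
theorem biasedMean_eq_biasedMean_layerDensity (p : ℝ) (Q : Finset V → Prop) [DecidablePred Q] :
    biasedMean p (univ : Finset V) (fun W => if Q W then 1 else 0) =
      biasedMean p (univ : Finset V) (fun W => layerDensity Q #W) := by
  rw [biasedMean, biasedMean, sum_powerset, sum_powerset]
  refine sum_congr rfl fun m hm => ?_
  have hm' : ((Fintype.card V).choose m : ℝ) ≠ 0 :=
    Nat.cast_ne_zero.2 (Nat.choose_pos (Nat.lt_succ_iff.1 (mem_range.1 hm))).ne'
  calc ∑ W ∈ powersetCard m univ, p ^ #W * (1 - p) ^ (#(univ : Finset V) - #W) *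
        (if Q W then 1 else 0)
      = ∑ W ∈ powersetCard m univ, p ^ m * (1 - p) ^ (#(univ : Finset V) - m) *
        (if Q W then 1 else 0) :=
        sum_congr rfl fun W hW => by rw [(mem_powersetCard.1 hW).2]
    _ = ∑ W ∈ powersetCard m (univ : Finset V), p ^ m * (1 - p) ^ (#(univ : Finset V) - m) *
        layerDensity Q m := by
        rw [← mul_sum, sum_boole, sum_const, card_powersetCard, nsmul_eq_mul, layerDensity,
          card_univ]
        field_simp
    _ = _ := sum_congr rfl fun W hW => by rw [(mem_powersetCard.1 hW).2]

-- Chernoff's method with the exponential moment of `#W`, using `e - 1 ≤ 2`; then `exp (-y / 2) ≤ 2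
-- / y`.
omit [DecidableEq V] in
theorem biasedMean_card_gt_le {p y : ℝ} (h0 : 0 ≤ p) (h1 : p ≤ 1) (hy : 0 < y) {m : ℕ}
    (hm : y ≤ m + 1) (hp : p * Fintype.card V ≤ y / 4) :
    biasedMean p (univ : Finset V) (fun W => if m < #W then 1 else 0) ≤ 2 / y := by
  have h2 : biasedMean p (univ : Finset V) (fun W => if m < #W then 1 else 0) ≤
      biasedMean p (univ : Finset V) (fun W => Real.exp (-y) * Real.exp 1 ^ #W) := by
    refine biasedMean_mono h0 h1 fun W _ => ?_
    rw [← Real.exp_nat_mul, mul_one, ← Real.exp_add]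
    split_ifs with h
    · have : (m : ℝ) + 1 ≤ #W := by exact_mod_cast h
      exact Real.one_le_exp (by linarith)
    · exact (Real.exp_pos _).le
  rw [biasedMean_const_mul, biasedMean_pow_card, card_univ] at h2
  have h3 : p * Real.exp 1 + (1 - p) ≤ Real.exp (2 * p) := by
    have := Real.add_one_le_exp (2 * p)
    nlinarith [Real.exp_one_lt_three]
  have h4 : (p * Real.exp 1 + (1 - p)) ^ Fintype.card V ≤ Real.exp (y / 2) := by
    refine (pow_le_pow_left₀ ?_ h3 _).trans ?_
    · have := mul_nonneg h0 (Real.exp_pos 1).le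
      linarith
    · rw [← Real.exp_nat_mul]
      exact Real.exp_le_exp.2 (by linarith)
  calc _ ≤ Real.exp (-y) * Real.exp (y / 2) :=
        h2.trans (mul_le_mul_of_nonneg_left h4 (Real.exp_pos _).le)
    _ = (Real.exp (y / 2))⁻¹ := by rw [← Real.exp_add, ← Real.exp_neg]; ring_nf
    _ ≤ (y / 2)⁻¹ := inv_anti₀ (by positivity) (by linarith [Real.add_one_le_exp (y / 2)])
    _ = 2 / y := inv_div _ _

/-- A biased set of size at most `m` satisfies `Q` at least as often as a uniform `m`-set; larger
sizes are charged to the tail bound. -/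
theorem layerDensity_le_biasedMean_add {p y : ℝ} (h0 : 0 ≤ p) (h1 : p ≤ 1) (hy : 0 < y) {m : ℕ}
    (hm : y ≤ m + 1) (hp : p * Fintype.card V ≤ y / 4) {Q : Finset V → Prop} [DecidablePred Q]
    (hQ : ∀ W W', W ⊆ W' → Q W' → Q W) :
    layerDensity Q m ≤ biasedMean p univ (fun W => if Q W then 1 else 0) + 2 / y := by
  have h : biasedMean p (univ : Finset V) (fun _ => layerDensity Q m) ≤
      biasedMean p (univ : Finset V) (fun W => layerDensity Q #W + if m < #W then 1 else 0) := by
    refine biasedMean_mono h0 h1 fun W _ => ?_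
    have h2 : 0 ≤ layerDensity Q #W := div_nonneg (Nat.cast_nonneg _) (Nat.cast_nonneg _)
    split_ifs with hW
    · linarith [layerDensity_le_one Q m]
    · linarith [layerDensity_antitone hQ (not_lt.1 hW)]
  rw [biasedMean_const, biasedMean_add, ← biasedMean_eq_biasedMean_layerDensity] at h
  linarith [biasedMean_card_gt_le (V := V) h0 h1 hy hm hp]

end FixedSize

/-! ### Application to spread hypergraphs -/

namespace MultiHypergraph

theorem one_sub_probContainsEdge {V : Type*} [Fintype V] [DecidableEq V]
    (H : MultiHypergraph V) {m : ℕ} (hm : m ≤ Fintype.card V) :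
    1 - H.probContainsEdge m = layerDensity (fun W => ¬ ∃ S ∈ H, S ⊆ W) m := by
  have hc : ((Fintype.card V).choose m : ℝ) ≠ 0 := Nat.cast_ne_zero.2 (Nat.choose_pos hm).ne'
  have h := card_filter_add_card_filter_not (s := powersetCard m (univ : Finset V))
    (fun W => ∃ S ∈ H, S ⊆ W)
  rw [card_powersetCard, card_univ] at h
  rw [probContainsEdge, layerDensity, card_powersetCard, card_univ, eq_div_iff hc, sub_mul,
    div_mul_cancel₀ _ hc, one_mul, ← h]
  push_cast
  ring

theorem countP_eq_card_filter {V : Type*} [DecidableEq V] (H : MultiHypergraph V)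
    (Q : Finset V → Prop) [DecidablePred Q] :
    H.countP Q = #{e : H | Q e.1} := by
  conv_lhs => rw [← Multiset.map_univ_coe H, Multiset.countP_map]
  rfl

theorem IsSpread.exists_biasedMean_le {V : Type*} [Fintype V] [DecidableEq V]
    {H : MultiHypergraph V} {q x : ℝ} {ℓ : ℕ} {r : ℕ → ℕ} (hH : H.IsSpread q (ℓ + 1) r)
    (hℓ : 1 ≤ ℓ) (hr : r (ℓ + 1) = 1) (hx : 16 ≤ x) (hxq : 2 * x * ℓ * q ≤ 1) :
    ∃ P : ℝ, 0 ≤ P ∧ P ≤ 1 ∧ P ≤ 3 * (q * x * ℓ) ∧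
      biasedMean P univ (fun W => if ¬ ∃ S ∈ H, S ⊆ W then 1 else 0) ≤ 8 / (x * ℓ) := by
  have hne : Nonempty H := by
    obtain ⟨S, hS⟩ := Multiset.exists_mem_of_ne_zero hH.nonempty
    exact ⟨⟨S, ⟨0, Multiset.count_pos.2 hS⟩⟩⟩
  have hb : ∀ a, a ≤ ℓ → a + 1 ≤ r (ℓ + 1 - a) := by
    intro a
    induction a with
    | zero => intro _; rw [Nat.sub_zero, hr]
    | succ a ih =>
      intro ha
      have h1 := hH.decreasing (ℓ + 1 - (a + 1)) (by omega) (by omega)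
      rw [show ℓ + 1 - (a + 1) + 1 = ℓ + 1 - a by omega] at h1
      have := ih (by omega)
      omega
  have hspread : ∀ a < ℓ, ∀ e : H, ∀ A ⊆ e.1, #A ≤ r (ℓ + 1 - (a + 1)) →
      ∀ j, r (ℓ + 1 - a) ≤ j →
      (#{e' : H | j ≤ #(A ∩ e'.1)} : ℝ) ≤ q ^ j * Fintype.card H := by
    intro a ha e A hA hAr j hj
    rw [Multiset.card_coe, ← countP_eq_card_filter H (fun S => j ≤ #(A ∩ S))]
    -- Below the scale window no edge can meet `A` in `j` vertices, so spreadness is needed only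
    -- inside it.
    by_cases hAa : r (ℓ + 1 - a) ≤ #A
    · have hi : ℓ + 1 - (a + 1) + 1 = ℓ + 1 - a := by omega
      refine hH.spread A ?_ (ℓ + 1 - (a + 1)) (by omega) (by omega) hAr (by rwa [hi]) j
        (by rwa [hi])
      exact Multiset.countP_pos.2 ⟨e.1, Multiset.coe_mem, hA⟩
    · have h0 : H.countP (fun S => j ≤ #(A ∩ S)) = 0 := by
        refine Multiset.countP_eq_zero.2 fun S _ hS => ?_
        have := hS.trans (card_le_card inter_subset_left)
        exact hAa (hj.trans this)
      rw [h0, Nat.cast_zero]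
      exact mul_nonneg (pow_nonneg hH.q_pos.le _) (Nat.cast_nonneg _)
  obtain ⟨P, hP0, hP1, hPle, hP⟩ := exists_biasedMean_no_edge_le (ι := H)
    (fun a => r (ℓ + 1 - a)) (fun e => e.1) hH.q_pos hx hℓ hxq hr hb hspread (ℓ - 1) (by omega)
  refine ⟨P, hP0, hP1, hPle.trans ?_, ?_⟩
  · have h1 : ((ℓ - 1 : ℕ) : ℝ) ≤ ℓ := Nat.cast_le.2 (Nat.sub_le _ _)
    have h2 : (ℓ : ℝ) * (1 - (1 / 2) ^ (ℓ - 1)) ≤ ℓ * 1 := by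
      refine mul_le_mul_of_nonneg_left ?_ (Nat.cast_nonneg _)
      linarith [pow_pos (by norm_num : (0 : ℝ) < 1 / 2) (ℓ - 1)]
    have hqx : 0 ≤ q * x := mul_nonneg hH.q_pos.le (by linarith)
    calc _ ≤ q * x * (ℓ + ℓ + ℓ * 1) := by gcongr
      _ = _ := by ring
  · have h1 := hP univ (fun e => e.1) (fun e _ => Subset.rfl) fun e _ => by
      rw [show ℓ + 1 - (ℓ - 1 + 1) = 1 by omega]
      exact hH.bounded _ Multiset.coe_mem
    rw [card_univ, sub_self, mul_zero, zero_add] at h1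
    refine (biasedMean_mono hP0 hP1 fun W _ => ?_).trans (h1.trans ?_)
    · have hiff : (¬ ∃ S ∈ H, S ⊆ W) ↔ ∀ e ∈ (univ : Finset H), ¬ e.1 ⊆ W := by
        constructor
        · exact fun h e _ hs => h ⟨e.1, Multiset.coe_mem, hs⟩
        · rintro h ⟨S, hS, hs⟩
          exact h ⟨S, ⟨0, Multiset.count_pos.2 hS⟩⟩ (mem_univ _) hs
      unfold noEdge
      simp only [hiff]
      exact le_rfl
    · have : 0 < x * ℓ := mul_pos (by linarith) (Nat.cast_pos.2 hℓ)
      refine div_le_div_of_nonneg_right ?_ this.le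
      linarith [pow_pos (by norm_num : (0 : ℝ) < 1 / 2) (ℓ - 1)]

end MultiHypergraph

theorem mainTheorem4 (K : ℝ) :
    ∃ K₀ : ℝ, 0 < K₀ ∧
      ∀ (V : Type*) [Fintype V] [DecidableEq V] (H : MultiHypergraph V)
        (q : ℝ) (ℓ : ℕ) (r : ℕ → ℕ) (C : ℝ),
        1 ≤ ℓ →
        r (ℓ + 1) = 1 →
        H.IsSpread q (ℓ + 1) r →
        (r 1 : ℝ) ≤ K * q * (Fintype.card V : ℝ) →
        (∀ i, 1 ≤ i → i < ℓ → H.minEdgeSize < r i →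
          Real.log (r i : ℝ) ≤ K * (r (i + 1) : ℝ)) →
        (r ℓ : ℝ) ≤ max (H.minEdgeSize : ℝ) (K₀ * Real.log ((ℓ : ℝ) + 1)) →
        K₀ ≤ C →
        C * (ℓ : ℝ) * q ≤ 1 →
        1 - K₀ / (C * (ℓ : ℝ)) ≤
          H.probContainsEdge ⌊C * (ℓ : ℝ) * q * (Fintype.card V : ℝ)⌋₊ := by
  -- `192 = 16 * 12` ensures `x = C / 12 ≥ 16`; `2 * |K|` covers the tail `2 / y`.
  refine ⟨192 + 2 * |K|, by positivity, ?_⟩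
  intro V _ _ H q ℓ r C hℓ hr hH hr1 _ _ hC hCq
  have hq := hH.q_pos
  have hK := abs_nonneg K
  have hℓ0 : (0 : ℝ) < ℓ := Nat.cast_pos.2 hℓ
  have hC0 : 0 < C := by linarith
  have hCℓ : 0 < C * ℓ := mul_pos hC0 hℓ0
  set n : ℝ := (Fintype.card V : ℝ) with hn
  have hn0 : 0 ≤ n := Nat.cast_nonneg _
  -- From `1 ≤ r 1 ≤ K q n`; this turns the tail `2 / y` into a multiple of `1 / (C * ℓ)`.
  have hKqn : 1 ≤ |K| * (q * n) := by
    have h1 : (1 : ℝ) ≤ r 1 := Nat.one_le_cast.2 (hH.pos 1 le_rfl (by omega))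
    have h2 : K * (q * n) ≤ |K| * (q * n) :=
      mul_le_mul_of_nonneg_right (le_abs_self K) (mul_nonneg hq.le hn0)
    rw [mul_assoc] at hr1
    linarith
  have hqn : 0 < q * n := by
    refine lt_of_le_of_ne (mul_nonneg hq.le hn0) fun h => ?_
    rw [← h, mul_zero] at hKqn
    linarith
  set y : ℝ := C * ℓ * q * n with hy
  have hyq : y = C * ℓ * (q * n) := by rw [hy]; ring
  have hy0 : 0 < y := hyq ▸ mul_pos hCℓ hqn
  have hfloor : ⌊y⌋₊ ≤ Fintype.card V := by
    refine Nat.floor_le_of_le ?_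
    calc y ≤ 1 * n := mul_le_mul_of_nonneg_right hCq hn0
      _ = Fintype.card V := one_mul n
  -- With this `x`, the density bound `3 * (q * x * ℓ)` is a quarter of `C * ℓ * q`, as the tail
  -- bound requires.
  obtain ⟨P, hP0, hP1, hPle, hP⟩ := hH.exists_biasedMean_le (x := C / 12) hℓ hr (by linarith)
    (by nlinarith)
  have hPn : P * n ≤ y / 4 := by
    calc P * n ≤ 3 * (q * (C / 12) * ℓ) * n := mul_le_mul_of_nonneg_right hPle hn0
      _ = y / 4 := by rw [hy]; ring
  have hlayer := layerDensity_le_biasedMean_add hP0 hP1 hy0 (Nat.lt_floor_add_one y).le hPn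
    (Q := fun W => ¬ ∃ S ∈ H, S ⊆ W)
    (fun W W' hW hQ => fun ⟨S, hS, hSW⟩ => hQ ⟨S, hS, hSW.trans hW⟩)
  rw [← H.one_sub_probContainsEdge hfloor] at hlayer
  have hyK : 2 / y ≤ 2 * |K| / (C * ℓ) := by
    rw [div_le_div_iff₀ hy0 hCℓ, hyq]
    nlinarith
  have hx : 8 / (C / 12 * ℓ) = 96 / (C * ℓ) := by
    field_simp
    norm_num
  have hsum : 96 / (C * ℓ) + 2 * |K| / (C * ℓ) ≤ (192 + 2 * |K|) / (C * ℓ) := by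
    rw [← add_div]
    exact div_le_div_of_nonneg_right (by linarith) hCℓ.le
  linarith
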